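/- All rings are commutative with identity. A ring $A$ is called \emph{semihereditary} if every finitely generated ideal of $A$ is projective as an $A$-module, and \emph{absolutely flat} if every $A$-module is flat. Let $R$ be a ring and let $T=\operatorname{Tot}(R)$ be its total ring of fractions, that is, the localization of $R$ at the set of all its regular elements (non-zero-divisors); regard $R$ as a subring of $T$. Let $$R+XT[X]=\{\, r+Xq \;:\; r\in R,\ q\in T[X] \,\},$$ a subring of the polynomial ring $T[X]$. Then $R+XT[X]$ is semihereditary if and only if $R$ is semihereditary and $T$ is absolutely flat. -/

import Mathlib

/-- A commutative ring is semihereditary if every finitely generated ideal is projective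
(as a module over the ring). -/
def IsSemihereditary (A : Type*) [CommRing A] : Prop :=
  ∀ I : Ideal A, I.FG → Module.Projective A I

/-- A commutative ring is absolutely flat if every module over it is flat. -/
def IsAbsolutelyFlat.{u} (A : Type u) [CommRing A] : Prop :=
  ∀ (M : Type u) [AddCommGroup M] [Module A M], Module.Flat A M

/-- The subring `R + X T[X]` of `T[X]`: the polynomials `r + X q` with `r` in (the image of) `R`
and `q` in `T[X]`. -/
def rPlusXTX (R T : Type*) [CommRing R] [CommRing T] [Algebra R T] :
    Subring (Polynomial T) where
  carrier := {f | ∃ (r : R) (q : Polynomial T),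
    f = Polynomial.C (algebraMap R T r) + Polynomial.X * q}
  zero_mem' := ⟨0, 0, by simp⟩
  one_mem' := ⟨1, 0, by simp⟩
  add_mem' := by
    rintro _ _ ⟨r, q, rfl⟩ ⟨s, p, rfl⟩
    exact ⟨r + s, q + p, by simp only [map_add]; ring⟩
  neg_mem' := by
    rintro _ ⟨r, q, rfl⟩
    exact ⟨-r, -q, by simp only [map_neg]; ring⟩
  mul_mem' := by
    rintro _ _ ⟨r, q, rfl⟩ ⟨s, p, rfl⟩
    exact ⟨r * s, Polynomial.C (algebraMap R T r) * p + Polynomial.C (algebraMap R T s) * q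
      + Polynomial.X * q * p, by simp only [map_mul]; ring⟩

/-!
Absolute flatness of `T` is used in the form of von Neumann regularity: every `t` satisfies
`t = t * t * s` for some `s`. Projectivity of a finitely generated module is used through the
criterion `projective_span_range_iff`, which expresses a splitting of a free presentation as a
matrix. Write `S` for `R + X T[X]`.

If `S` is semihereditary, so is its retract `R`: apply the constant coefficient to the matrix
of an extended ideal (`IsSemihereditary.of_rPlusXTX`). Projectivity of the ideals `(a, X)` of `S`
with `a` in `R` forces `T` to be von Neumann regular
(`IsSemihereditary.exists_eq_mul_mul_of_rPlusXTX`).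

Conversely, let `T` be von Neumann regular. Then `T[X]` is a Bézout ring, by the Euclidean
algorithm with idempotents splitting the ring wherever a leading coefficient is neither zero nor
invertible (`Polynomial.isBezout_of_forall_exists_eq_mul_mul`), and every polynomial is a regular
element times an idempotent constant (`Polynomial.exists_nonZeroDivisor_mul_idempotent`). Hence a
finitely generated ideal `I` of `S` generates an ideal `k e T[X]` with `k` regular and `e` in `T`
idempotent. Dividing by `k` gives an isomorphic `S`-submodule of `T[X]` which generates the ideal
`e T[X]`, so it contains `X e T[X]` and is generated by the constant coefficients of its generators
(`span_range_eq_span_range_C_coeff_zero`). Up to a common denominator it is thus extended from a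
finitely generated ideal of `R`, and it inherits projectivity from that ideal
(`IsSemihereditary.projective_span_range_C`).
-/

open Polynomial

/-! ### A splitting criterion for projectivity -/

/-- A submodule generated by finitely many elements `a i` is projective iff the canonical surjection
from the free module onto it splits. The splitting is recorded by the matrix `P` whose `j`-th row
is the image of `a j`: the rows have to respect the relations between the `a j` and to map back to
the `a j`. In this form projectivity can be moved between rings elementwise. -/
theorem projective_span_range_iff {A M ι : Type*} [CommRing A] [AddCommGroup M] [Module A M]
    [Fintype ι] (a : ι → M) :
    Module.Projective A (Submodule.span A (Set.range a)) ↔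
      ∃ P : ι → ι → A, (∀ j, a j = ∑ i, P j i • a i) ∧
        ∀ r : ι → A, ∑ j, r j • a j = 0 → ∀ i, ∑ j, r j * P j i = 0 := by
  classical
  let φ := Fintype.linearCombination A a
  have hφ : LinearMap.range φ = Submodule.span A (Set.range a) :=
    Fintype.range_linearCombination A a
  rw [← hφ]
  constructor
  · intro _
    obtain ⟨σ, hσ⟩ := Module.projective_lifting_property φ.rangeRestrict LinearMap.id
      φ.surjective_rangeRestrict
    have hσ' (x : LinearMap.range φ) : φ (σ x) = x :=
      congrArg Subtype.val (LinearMap.congr_fun hσ x)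
    have hφa (r : ι → A) : φ r = ∑ j, r j • a j := Fintype.linearCombination_apply A a r
    have ha (j : ι) : φ (Pi.single j 1) = a j := by simp [φ, Fintype.linearCombination_apply_single]
    refine ⟨fun j => σ (φ.rangeRestrict (Pi.single j 1)), fun j => ?_, fun r hr i => ?_⟩
    · rw [← hφa, hσ']
      exact (ha j).symm
    · have h0 : φ.rangeRestrict r = 0 := Subtype.ext ((hφa r).trans hr)
      have h1 : r = ∑ j, r j • (Pi.single j 1 : ι → A) := by
        ext k; simp [Pi.single_apply]
      rw [h1, map_sum] at h0
      have h2 := congrFun (congrArg σ h0) i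
      simpa using h2
  · rintro ⟨P, hP, hrel⟩
    let Q : (ι → A) →ₗ[A] (ι → A) := Fintype.linearCombination A P
    have hker : LinearMap.ker φ ≤ LinearMap.ker Q := by
      intro r hr
      rw [LinearMap.mem_ker, Fintype.linearCombination_apply] at hr ⊢
      ext i
      simpa using hrel r hr i
    have hφQ (r : ι → A) : φ (Q r) = φ r := by
      simp only [φ, Q, Fintype.linearCombination_apply A P, map_sum, map_smul]
      simp only [Fintype.linearCombination_apply, ← hP]
    refine Module.Projective.of_split
      ((LinearMap.ker φ).liftQ Q hker ∘ₗ φ.quotKerEquivRange.symm.toLinearMap) φ.rangeRestrict ?_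
    ext ⟨_, r, rfl⟩
    have : φ.quotKerEquivRange.symm ⟨φ r, r, rfl⟩ = (LinearMap.ker φ).mkQ r := by
      rw [LinearEquiv.symm_apply_eq]
      rfl
    simp [this, hφQ]

theorem Ideal.FG.exists_eq_span_range_fin {A : Type*} [CommRing A] {I : Ideal A} (hI : I.FG) :
    ∃ (n : ℕ) (a : Fin n → A), Ideal.span (Set.range a) = I :=
  Submodule.fg_iff_exists_fin_generating_family.1 hI

/-! ### Absolutely flat rings and von Neumann regularity -/

theorem IsAbsolutelyFlat.exists_eq_mul_mul {A : Type*} [CommRing A] (h : IsAbsolutelyFlat A)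
    (t : A) : ∃ s, t = t * t * s := by
  have : (Ideal.span {t}).Pure := h _
  have ht : t ∈ Ideal.span {t} * Ideal.span {t} := by
    rw [(Ideal.isIdempotentElem_of_pure _).eq]
    exact Ideal.mem_span_singleton_self t
  rw [Ideal.span_singleton_mul_span_singleton, Ideal.mem_span_singleton'] at ht
  obtain ⟨s, hs⟩ := ht
  exact ⟨s, by rw [mul_comm, hs]⟩

theorem Ideal.FG.exists_isIdempotentElem_eq_span {A : Type*} [CommRing A]
    (h : ∀ t : A, ∃ s, t = t * t * s) {I : Ideal A} (hI : I.FG) :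
    ∃ e : A, IsIdempotentElem e ∧ I = Ideal.span {e} := by
  refine (Ideal.isIdempotentElem_iff_of_fg I hI).1 (le_antisymm Ideal.mul_le_left fun t ht => ?_)
  obtain ⟨s, hs⟩ := h t
  rw [hs]
  exact Ideal.mul_mem_right _ _ (Ideal.mul_mem_mul ht ht)

open TensorProduct in
/-- Every finitely generated ideal is generated by an idempotent `e`, so an element of
`(e) ⊗ M` is of the form `e ⊗ m`; if `e • m = 0`, then `e ⊗ m = e ⊗ (e • m) = 0`. -/
theorem isAbsolutelyFlat_of_forall_exists_eq_mul_mul {A : Type*} [CommRing A]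
    (h : ∀ t : A, ∃ s, t = t * t * s) : IsAbsolutelyFlat A := by
  intro M _ _
  rw [Module.Flat.iff_lift_lsmul_comp_subtype_injective]
  intro I hI
  obtain ⟨e, he, rfl⟩ := hI.exists_isIdempotentElem_eq_span h
  let e' : Ideal.span {e} := ⟨e, Ideal.mem_span_singleton_self e⟩
  have hz (z : Ideal.span {e} ⊗[A] M) : ∃ m : M, z = e' ⊗ₜ m := by
    induction z with
    | zero => exact ⟨0, (tmul_zero _ _).symm⟩
    | tmul x m =>
      obtain ⟨x, hx⟩ := x
      obtain ⟨c, rfl⟩ := Ideal.mem_span_singleton'.1 hx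
      exact ⟨c • m, by rw [← smul_tmul]; rfl⟩
    | add x y hx hy =>
      obtain ⟨m, rfl⟩ := hx
      obtain ⟨n, rfl⟩ := hy
      exact ⟨m + n, (tmul_add _ _ _).symm⟩
  rw [injective_iff_map_eq_zero]
  intro z h0
  obtain ⟨m, rfl⟩ := hz z
  have hem : e • m = 0 := h0
  have hee : e' = e • e' := Subtype.ext he.eq.symm
  rw [hee, smul_tmul, hem, tmul_zero]

/-! ### Polynomials over a von Neumann regular ring -/

/-- Whether an ideal generated by two elements is principal can be checked on the two factors
of the ring that an idempotent cuts out. -/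
theorem Ideal.isPrincipal_span_pair_of_isIdempotentElem {A : Type*} [CommRing A] {e f g : A}
    (he : IsIdempotentElem e) (h₁ : (Ideal.span {e * f, e * g}).IsPrincipal)
    (h₂ : (Ideal.span {(1 - e) * f, (1 - e) * g}).IsPrincipal) :
    (Ideal.span {f, g}).IsPrincipal := by
  obtain ⟨d₁, h₁⟩ := h₁
  obtain ⟨d₂, h₂⟩ := h₂
  rw [Ideal.submodule_span_eq] at h₁ h₂
  have m₁ : d₁ ∈ Ideal.span {e * f, e * g} := h₁ ▸ Ideal.mem_span_singleton_self d₁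
  have m₂ : d₂ ∈ Ideal.span {(1 - e) * f, (1 - e) * g} := h₂ ▸ Ideal.mem_span_singleton_self d₂
  have hef : e * f ∈ Ideal.span {d₁} := h₁ ▸ Ideal.subset_span (by simp)
  have heg : e * g ∈ Ideal.span {d₁} := h₁ ▸ Ideal.subset_span (by simp)
  have hef' : (1 - e) * f ∈ Ideal.span {d₂} := h₂ ▸ Ideal.subset_span (by simp)
  have heg' : (1 - e) * g ∈ Ideal.span {d₂} := h₂ ▸ Ideal.subset_span (by simp)
  rw [Ideal.mem_span_pair] at m₁ m₂
  rw [Ideal.mem_span_singleton'] at hef heg hef' heg'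
  obtain ⟨a₁, b₁, rfl⟩ := m₁
  obtain ⟨a₂, b₂, rfl⟩ := m₂
  obtain ⟨u, hu⟩ := hef
  obtain ⟨v, hv⟩ := heg
  obtain ⟨u', hu'⟩ := hef'
  obtain ⟨v', hv'⟩ := heg'
  have hee := he.eq
  refine ⟨(a₁ * (e * f) + b₁ * (e * g)) + (a₂ * ((1 - e) * f) + b₂ * ((1 - e) * g)), ?_⟩
  rw [Ideal.submodule_span_eq]
  refine le_antisymm (Ideal.span_le.2 ?_) (Ideal.span_le.2 ?_)
  · rintro x (rfl | rfl)
    · refine Ideal.mem_span_singleton'.2 ⟨u * e + u' * (1 - e), ?_⟩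
      linear_combination hu + hu' + (u - u') * (a₁ * x + b₁ * g - a₂ * x - b₂ * g) * hee
    · refine Ideal.mem_span_singleton'.2 ⟨v * e + v' * (1 - e), ?_⟩
      linear_combination hv + hv' + (v - v') * (a₁ * f + b₁ * x - a₂ * f - b₂ * x) * hee
  · rintro x rfl
    exact Ideal.mem_span_pair.2 ⟨a₁ * e + a₂ * (1 - e), b₁ * e + b₂ * (1 - e), by ring⟩

/-- The Euclidean algorithm over a von Neumann regular ring. The candidate leading coefficient `c`
of the divisor generates an ideal `(c * s)` with `c * s` idempotent. On the factor given by `c * s`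
it is invertible and a division step lowers the degree of the dividend; on the complementary factor
it vanishes, so that the degree of the divisor drops. -/
theorem Polynomial.isPrincipal_span_pair_of_degree_lt {T : Type*} [CommRing T]
    (h : ∀ t : T, ∃ s, t = t * t * s) (N : ℕ) :
    ∀ (m n : ℕ) (f g : T[X]), m + n ≤ N → f.degree < m → g.degree < n →
      (Ideal.span {f, g}).IsPrincipal := by
  induction N with
  | zero =>
    intro m n f g hmn hf hg
    obtain ⟨rfl, rfl⟩ : m = 0 ∧ n = 0 := by omega
    have hf0 : f = 0 := by simpa using hf
    have hg0 : g = 0 := by simpa using hg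
    subst hf0 hg0
    exact ⟨0, by rw [Ideal.submodule_span_eq, Ideal.span_pair_zero]⟩
  | succ N ih =>
    have key : ∀ (m n : ℕ) (f g : T[X]), n ≤ m → m + n ≤ N + 1 → f.degree < m → g.degree < n →
        (Ideal.span {f, g}).IsPrincipal := by
      intro m n f g hle hmn hf hg
      obtain _ | n := n
      · have : g = 0 := by simpa using hg
        subst this
        exact ⟨f, by rw [Ideal.submodule_span_eq, Ideal.span_pair_zero]⟩
      obtain ⟨m, rfl⟩ : ∃ k, m = k + 1 := ⟨m - 1, by omega⟩
      obtain ⟨s, hs⟩ := h (g.coeff n)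
      have hdrop {p : T[X]} {k : ℕ} (hp : p.degree < (k + 1 : ℕ)) (hk : p.coeff k = 0) :
          p.degree < k := by
        rw [degree_lt_iff_coeff_zero] at hp ⊢
        intro i hi
        obtain rfl | hi := hi.eq_or_lt
        · exact hk
        · exact hp i hi
      have hC {p : T[X]} {k : ℕ} (c : T) (hp : p.degree < (k : ℕ)) : (C c * p).degree < k := by
        rw [degree_lt_iff_coeff_zero] at hp ⊢
        intro i hi
        rw [coeff_C_mul, hp i hi, mul_zero]
      set c := g.coeff n with hc
      have hidem : IsIdempotentElem (c * s) := by
        rw [IsIdempotentElem]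
        linear_combination -s * hs
      apply Ideal.isPrincipal_span_pair_of_isIdempotentElem (hidem.map C)
      · -- `s * f.coeff m` is the leading coefficient of the quotient on this factor.
        rw [← Ideal.span_pair_add_mul_right (z := C (-(s * f.coeff m)) * X ^ (m - n))]
        have hcoeff (i : ℕ) (hi : m ≤ i) :
            (C (c * s) * f + C (-(s * f.coeff m)) * X ^ (m - n) * (C (c * s) * g)).coeff i =
              c * s * f.coeff i - s * f.coeff m * (c * s * g.coeff (i - (m - n))) := by
          rw [mul_assoc, X_pow_mul, coeff_add, coeff_C_mul, coeff_C_mul, coeff_mul_X_pow',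
            if_pos (by omega), coeff_C_mul]
          ring
        refine ih m (n + 1) _ _ (by omega) (degree_lt_iff_coeff_zero _ _ |>.2 fun i hi => ?_)
          (hC _ hg)
        rw [hcoeff i hi]
        obtain rfl | hi := hi.eq_or_lt
        · rw [Nat.sub_sub_self (by omega), ← hc]
          linear_combination s * f.coeff m * hs
        · rw [degree_lt_iff_coeff_zero] at hf hg
          rw [hf i hi, hg _ (by omega)]
          ring
      · rw [← C_1, ← C_sub]
        refine ih (m + 1) n _ _ (by omega) (hC _ hf) (hdrop (hC _ hg) ?_)
        rw [coeff_C_mul]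
        linear_combination hs
    intro m n f g hmn hf hg
    obtain hle | hle := le_total n m
    · exact key m n f g hle hmn hf hg
    · rw [Ideal.span_pair_comm]
      exact key n m g f hle (by omega) hg hf

theorem Polynomial.isBezout_of_forall_exists_eq_mul_mul {T : Type*} [CommRing T]
    (h : ∀ t : T, ∃ s, t = t * t * s) : IsBezout T[X] := by
  rw [IsBezout.iff_span_pair_isPrincipal]
  intro f g
  have hd (p : T[X]) : p.degree < (p.natDegree + 1 : ℕ) :=
    degree_le_natDegree.trans_lt (by exact_mod_cast p.natDegree.lt_succ_self)
  exact isPrincipal_span_pair_of_degree_lt h _ _ _ f g le_rfl (hd f) (hd g)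

/-- The idempotent `e` is the generator of the content ideal of `d`, and the regular factor is
`d + (1 - e)`: by McCoy's theorem it is enough to test its regularity against constants. -/
theorem Polynomial.exists_nonZeroDivisor_mul_idempotent {T : Type*} [CommRing T]
    (h : ∀ t : T, ∃ s, t = t * t * s) (d : T[X]) :
    ∃ (k : T[X]) (e : T), k ∈ nonZeroDivisors T[X] ∧ IsIdempotentElem e ∧ d = k * C e := by
  classical
  obtain ⟨e, he, hI⟩ := Ideal.FG.exists_isIdempotentElem_eq_span h
    (I := Ideal.span (d.support.image d.coeff : Set T)) ⟨_, rfl⟩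
  have hde : d * C e = d := by
    ext i
    rw [coeff_mul_C]
    have hmem : d.coeff i ∈ Ideal.span {e} := by
      by_cases hi : d.coeff i = 0
      · rw [hi]
        exact zero_mem _
      · rw [← hI]
        exact Ideal.subset_span (by exact Finset.mem_image_of_mem _ (mem_support_iff.2 hi))
    obtain ⟨u, hu⟩ := Ideal.mem_span_singleton'.1 hmem
    rw [← hu, mul_assoc, he.eq]
  have hCe : C e * C e = C e := (he.map C).eq
  -- A constant `a` killing `d + (1 - e)` kills both summands, as these lie in complementary
  -- factors; so it kills the content `e` of `d` and also `1 - e`.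
  refine ⟨d + (1 - C e), e, Polynomial.mem_nonZeroDivisors_iff.2 fun a ha => ?_, he, ?_⟩
  · rw [smul_eq_C_mul] at ha
    have had : C a * d = 0 := by
      linear_combination C e * ha - C a * hde + C a * hCe
    have hae : a * e = 0 := by
      have hle : Ideal.span {e} ≤ Submodule.annihilator (Submodule.span T {a}) := by
        rw [← hI, Ideal.span_le]
        intro x hx
        obtain ⟨i, -, rfl⟩ := Finset.mem_image.1 (Finset.mem_coe.1 hx)
        rw [SetLike.mem_coe, Submodule.mem_annihilator_span_singleton, smul_eq_mul, mul_comm,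
          ← coeff_C_mul, had, coeff_zero]
      have := hle (Ideal.mem_span_singleton_self e)
      rwa [Submodule.mem_annihilator_span_singleton, smul_eq_mul, mul_comm] at this
    have haC : C a * C e = 0 := by rw [← C_mul, hae, C_0]
    exact C_eq_zero.1 (by linear_combination ha - had + haC)
  · linear_combination -hde + hCe

/-! ### The ring `R + X T[X]` -/

theorem mem_rPlusXTX_iff {R T : Type*} [CommRing R] [CommRing T] [Algebra R T] {f : T[X]} :
    f ∈ rPlusXTX R T ↔ ∃ r : R, algebraMap R T r = f.coeff 0 := by
  constructor
  · rintro ⟨r, q, rfl⟩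
    exact ⟨r, by simp⟩
  · rintro ⟨r, hr⟩
    exact ⟨r, f.divX, by rw [hr, add_comm, X_mul_divX_add]⟩

theorem C_algebraMap_mem_rPlusXTX {R T : Type*} [CommRing R] [CommRing T] [Algebra R T] (r : R) :
    C (algebraMap R T r) ∈ rPlusXTX R T :=
  mem_rPlusXTX_iff.2 ⟨r, by simp⟩

theorem X_mul_mem_rPlusXTX {R T : Type*} [CommRing R] [CommRing T] [Algebra R T] (q : T[X]) :
    X * q ∈ rPlusXTX R T :=
  mem_rPlusXTX_iff.2 ⟨0, by simp⟩

/-- The constant coefficient maps `R + X T[X]` onto `R`, and carries a splitting for the extended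
ideal to one for the ideal of `R`. -/
theorem IsSemihereditary.of_rPlusXTX {R T : Type*} [CommRing R] [CommRing T] [Algebra R T]
    (hinj : Function.Injective (algebraMap R T)) (h : IsSemihereditary (rPlusXTX R T)) :
    IsSemihereditary R := by
  intro I hI
  obtain ⟨n, a, rfl⟩ := hI.exists_eq_span_range_fin
  let ι (r : R) : rPlusXTX R T := ⟨C (algebraMap R T r), C_algebraMap_mem_rPlusXTX r⟩
  let ev : rPlusXTX R T →+* T := constantCoeff.comp (rPlusXTX R T).subtype
  have hev (r : R) : ev (ι r) = algebraMap R T r := by simp [ev, ι]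
  choose π hπ using fun f : rPlusXTX R T => mem_rPlusXTX_iff.1 f.2
  replace hπ (f : rPlusXTX R T) : algebraMap R T (π f) = ev f := hπ f
  obtain ⟨P, hP, hrel⟩ := (projective_span_range_iff (fun i => ι (a i))).1
    (h _ (Submodule.fg_span (Set.finite_range _)))
  refine (projective_span_range_iff a).2 ⟨fun j i => π (P j i), fun j => hinj ?_,
    fun r hr i => hinj ?_⟩
  · simpa [hπ, hev] using congrArg ev (hP j)
  · have h0 : ∑ j, ι (r j) • ι (a j) = 0 := by
      refine Subtype.ext ?_
      have := congrArg (fun x => C (algebraMap R T x)) hr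
      simpa [ι] using this
    simpa [hπ, hev] using congrArg ev (hrel _ h0 i)

/-- For `a` in `R` the regularity relation `a = a * a * s` is read off from the low coefficients of
a splitting for the ideal `(a, X)` and the relation `X * a - a * X = 0`. The general case follows
because denominators are units of `T`. -/
theorem IsSemihereditary.exists_eq_mul_mul_of_rPlusXTX {R T : Type*} [CommRing R] [CommRing T]
    [Algebra R T] [IsFractionRing R T] (h : IsSemihereditary (rPlusXTX R T)) (t : T) :
    ∃ s, t = t * t * s := by
  have key (a : R) : ∃ s, algebraMap R T a = algebraMap R T a * algebraMap R T a * s := by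
    let x : rPlusXTX R T := ⟨X * 1, X_mul_mem_rPlusXTX 1⟩
    let y : rPlusXTX R T := ⟨C (algebraMap R T a), C_algebraMap_mem_rPlusXTX a⟩
    obtain ⟨P, hP, hrel⟩ := (projective_span_range_iff ![y, x]).1
      (h _ (Submodule.fg_span (Set.finite_range _)))
    -- `h1` compares the coefficients of `X` in `X = P₁₀ a + P₁₁ X`, and `h2` the constant
    -- coefficients in `X P₀₁ - a P₁₁ = 0`. By `h2`, multiplying `h1` by `a` removes the term
    -- with `P₁₁`.
    have h1 := congrArg (fun f : rPlusXTX R T => (f : T[X]).coeff 1) (hP 1)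
    have h2 := congrArg (fun f : rPlusXTX R T => (f : T[X]).coeff 0)
      (hrel ![x, -y] (by simp [mul_comm]) 1)
    simp [x, y] at h1 h2
    refine ⟨(P 1 0 : T[X]).coeff 1, ?_⟩
    linear_combination algebraMap R T a * h1 + h2
  obtain ⟨⟨a, b⟩, hab⟩ := IsLocalization.surj (nonZeroDivisors R) t
  obtain ⟨s, hs⟩ := key a
  refine ⟨algebraMap R T b * s, (IsLocalization.map_units T b).mul_right_cancel ?_⟩
  dsimp only at hab
  linear_combination hab + hs - (t * algebraMap R T b + algebraMap R T a) * s * hab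

/-- The generators are constants with entries in `T`. After multiplication by a common denominator
they generate an ideal of `R`; a splitting for that ideal also works over `R + X T[X]`, since a
relation with polynomial coefficients amounts to relations over `T`, one in each degree, and each
of these becomes a relation over `R` once denominators are cleared. -/
theorem IsSemihereditary.projective_span_range_C {R T : Type*} [CommRing R] [CommRing T]
    [Algebra R T] [IsFractionRing R T] (h : IsSemihereditary R) {n : ℕ} (c : Fin n → T) :
    Module.Projective (rPlusXTX R T)
      (Submodule.span (rPlusXTX R T) (Set.range fun i => C (c i))) := by
  have hinj := IsFractionRing.injective R T
  obtain ⟨b, hb⟩ := IsLocalization.exist_integer_multiples_of_finite (nonZeroDivisors R) c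
  choose a ha using hb
  simp only [Algebra.smul_def] at ha
  have hbu := IsLocalization.map_units T b
  obtain ⟨P, hP, hrel⟩ := (projective_span_range_iff a).1
    (h _ (Submodule.fg_span (Set.finite_range _)))
  have hPT (j : Fin n) : c j = ∑ i, algebraMap R T (P j i) * c i := by
    refine hbu.mul_left_cancel ?_
    have := congrArg (algebraMap R T) (hP j)
    simp only [smul_eq_mul, map_sum, map_mul, ha] at this
    rw [this, Finset.mul_sum]
    exact Finset.sum_congr rfl fun i _ => by ring
  have hrelT (t : Fin n → T) (ht : ∑ j, t j * c j = 0) (i : Fin n) :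
      ∑ j, t j * algebraMap R T (P j i) = 0 := by
    obtain ⟨b', hb'⟩ := IsLocalization.exist_integer_multiples_of_finite (nonZeroDivisors R) t
    choose r hr using hb'
    simp only [Algebra.smul_def] at hr
    refine (IsLocalization.map_units T b').mul_left_cancel ?_
    have h0 : ∑ j, r j • a j = 0 := by
      refine hinj ?_
      simp only [smul_eq_mul, map_sum, map_mul, ha, hr, map_zero]
      calc _ = algebraMap R T b' * algebraMap R T b * ∑ j, t j * c j := by
            rw [Finset.mul_sum]
            exact Finset.sum_congr rfl fun i _ => by ring
        _ = 0 := by rw [ht, mul_zero]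
    have := congrArg (algebraMap R T) (hrel r h0 i)
    simp only [map_sum, map_mul, hr, map_zero] at this
    rw [mul_zero, ← this, Finset.mul_sum]
    exact Finset.sum_congr rfl fun i _ => by ring
  refine (projective_span_range_iff _).2
    ⟨fun j i => ⟨C (algebraMap R T (P j i)), C_algebraMap_mem_rPlusXTX _⟩, fun j => ?_,
      fun r hr i => Subtype.ext ?_⟩
  · simp only [Subring.smul_def, smul_eq_mul, ← C_mul, ← map_sum, ← hPT]
  · ext m
    have := congrArg (fun f : T[X] => f.coeff m) hr
    simp only [Subring.smul_def, smul_eq_mul, finsetSum_coeff, coeff_mul_C, coeff_zero] at this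
    simpa [finsetSum_coeff] using hrelT _ this i

/-- If the `g i` generate the ideal `(e)` of `T[X]` for an idempotent constant `e`, then they and
their constant coefficients generate the same `R + X T[X]`-submodule of `T[X]`. Both contain
`X e T[X]`, as multiplication by elements of `X T[X]` is available, and
`g i` differs from its constant coefficient by an element of `X e T[X]`. -/
theorem span_range_eq_span_range_C_coeff_zero {R T : Type*} [CommRing R] [CommRing T] [Algebra R T]
    {n : ℕ} {g u : Fin n → T[X]} {e : T} (hg : ∀ i, g i * C e = g i)
    (hu : C e = ∑ i, u i * g i) :
    Submodule.span (rPlusXTX R T) (Set.range g) =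
      Submodule.span (rPlusXTX R T) (Set.range fun i => C ((g i).coeff 0)) := by
  have hX (N : Submodule (rPlusXTX R T) T[X]) {p : T[X]} (q : T[X]) (hp : p ∈ N) :
      X * q * p ∈ N :=
    N.smul_mem ⟨X * q, X_mul_mem_rPlusXTX q⟩ hp
  have hdecomp (i : Fin n) : X * (g i).divX + C ((g i).coeff 0) = g i := X_mul_divX_add _
  have he : C e = ∑ i, C ((u i).coeff 0) * C ((g i).coeff 0) := by
    have := congrArg (fun f : T[X] => C (f.coeff 0)) hu
    simpa [finsetSum_coeff, mul_coeff_zero] using this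
  have hq (i : Fin n) : X * (g i).divX = X * (g i).divX * C e := by
    have h0 : (g i).coeff 0 * e = (g i).coeff 0 := by rw [← coeff_mul_C, hg]
    have h0C : C ((g i).coeff 0) * C e = C ((g i).coeff 0) := by rw [← C_mul, h0]
    linear_combination hdecomp i - hdecomp i * C e - hg i + h0C
  refine le_antisymm (Submodule.span_le.2 ?_) (Submodule.span_le.2 ?_)
  · rintro _ ⟨i, rfl⟩
    rw [SetLike.mem_coe, ← hdecomp i, hq i, he, Finset.mul_sum]
    refine add_mem (sum_mem fun j _ => ?_) (Submodule.subset_span ⟨i, rfl⟩)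
    rw [← mul_assoc, mul_assoc X]
    exact hX _ _ (Submodule.subset_span ⟨j, rfl⟩)
  · rintro _ ⟨i, rfl⟩
    have : C ((g i).coeff 0) = g i - ∑ j, X * ((g i).divX * u j) * g j := by
      rw [eq_sub_iff_add_eq]
      calc _ = C ((g i).coeff 0) + X * (g i).divX * C e := by
            rw [hu, Finset.mul_sum]
            simp only [mul_assoc]
        _ = g i := by rw [← hq, add_comm, hdecomp]
    rw [SetLike.mem_coe]
    dsimp only
    rw [this]
    exact sub_mem (Submodule.subset_span ⟨i, rfl⟩)
      (sum_mem fun j _ => hX _ _ (Submodule.subset_span ⟨j, rfl⟩))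

/-- A finitely generated ideal of `R + X T[X]` is, as a module, isomorphic to a submodule of `T[X]`
generated by constants: the isomorphism is multiplication by the regular factor `k` of a generator
of the extended ideal in `T[X]`. -/
theorem isSemihereditary_rPlusXTX {R T : Type*} [CommRing R] [CommRing T] [Algebra R T]
    [IsFractionRing R T] (hR : IsSemihereditary R) (hT : ∀ t : T, ∃ s, t = t * t * s) :
    IsSemihereditary (rPlusXTX R T) := by
  intro I hI
  obtain ⟨n, f, rfl⟩ := hI.exists_eq_span_range_fin
  have := Polynomial.isBezout_of_forall_exists_eq_mul_mul hT
  obtain ⟨d, hd⟩ := IsBezout.isPrincipal_of_FG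
    (Ideal.span (Set.range fun i => (f i : T[X]))) (Submodule.fg_span (Set.finite_range _))
  rw [Ideal.submodule_span_eq] at hd
  obtain ⟨k, e, hk, he, rfl⟩ := Polynomial.exists_nonZeroDivisor_mul_idempotent hT d
  have hf (i : Fin n) : ∃ q, q * (k * C e) = f i :=
    Ideal.mem_span_singleton'.1 (hd ▸ Ideal.subset_span ⟨i, rfl⟩)
  choose q hq using hf
  obtain ⟨u, hu⟩ := Ideal.mem_span_range_iff_exists_fun.1
    (hd.ge (Ideal.mem_span_singleton_self (k * C e)))
  have hCe : C e * C e = C e := (he.map C).eq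
  let g (i : Fin n) : T[X] := q i * C e
  have hfg (i : Fin n) : k * g i = f i := by rw [← hq i]; ring
  -- The quotients `g i` generate the ideal `(e)` of `T[X]`, since `k` cancels.
  have hug : C e = ∑ i, u i * g i := by
    refine (mul_cancel_left_mem_nonZeroDivisors hk).1 ?_
    rw [← hu, Finset.mul_sum]
    exact Finset.sum_congr rfl fun i _ => by rw [← hfg]; ring
  have hproj := hR.projective_span_range_C fun i => (g i).coeff 0
  rw [← span_range_eq_span_range_C_coeff_zero (fun i => by rw [mul_assoc, hCe]) hug] at hproj
  let μ : T[X] →ₗ[rPlusXTX R T] T[X] := LinearMap.mulLeft _ k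
  have hμ : Function.Injective μ := fun p p' hp => (mul_cancel_left_mem_nonZeroDivisors hk).1 hp
  let j : rPlusXTX R T →ₗ[rPlusXTX R T] T[X] :=
    Algebra.linearMap (rPlusXTX R T) T[X]
  have hj : Function.Injective j := Subtype.val_injective
  -- Inside `T[X]`, the ideal is `k` times the module generated by the `g i`.
  have hmap : (Submodule.span _ (Set.range g)).map μ =
      Submodule.map j (Ideal.span (Set.range f)) := by
    rw [Submodule.map_span, Ideal.span, Submodule.map_span, ← Set.range_comp, ← Set.range_comp]
    congr 2
    exact funext hfg
  exact Module.Projective.of_equiv ((Submodule.equivMapOfInjective μ hμ _).trans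
    ((LinearEquiv.ofEq _ _ hmap).trans (Submodule.equivMapOfInjective j hj _).symm))

/-! ### The equivalence -/

theorem mainTheorem9 {R T : Type*} [CommRing R] [CommRing T] [Algebra R T]
    [IsFractionRing R T] :
    IsSemihereditary (rPlusXTX R T) ↔ IsSemihereditary R ∧ IsAbsolutelyFlat T :=
  ⟨fun h => ⟨h.of_rPlusXTX (IsFractionRing.injective R T),
    isAbsolutelyFlat_of_forall_exists_eq_mul_mul h.exists_eq_mul_mul_of_rPlusXTX⟩,
    fun ⟨hR, hT⟩ => isSemihereditary_rPlusXTX hR hT.exists_eq_mul_mul⟩
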